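/- **Theorem 5.** Let $\mathsf{AP}$ be a countable set of atomic propositions, and let formulas be given by $\phi ::= p \mid \bot \mid \neg\phi \mid (\phi\land\phi) \mid \mathtt X\phi \mid \mathtt Y\phi \mid [\mathtt S]\phi \mid [\mathtt W]\phi$ with $p\in\mathsf{AP}$; the connectives $\top,\lor,\to,\leftrightarrow$ are defined as usual and $\langle\mathtt S\rangle\phi := \neg[\mathtt S]\neg\phi$. Then for every formula $\phi$: $\phi$ is derivable in the axiomatic system $\mathsf{SWONBT}$ if and only if $\phi$ is valid, where these notions are as follows. *Models.* A model is $\mathtt M=(W,<,V)$, where $W$ is a nonempty set of states, $V:\mathsf{AP}\to\mathcal P(W)$, and $<$ is a serial relation on $W$ (every state has a $<$-successor) for which there is a root $r\in W$ such that for every $w\in W$ there is a unique finite sequence $x_0<\dots<x_n$ ($n\ge 0$, consecutive elements being related) with $x_0=r$ and $x_n=w$. A timeline is an infinite sequence $\pi[0]<\pi[1]<\cdots$ with $\pi[0]=r$. *Contexts.* A context for $\mathtt M$ is $\mathtt C=(\mathbb L,\succ,\mathbb U)$, where $\mathbb L$ is a finite set of sets of timelines (the ontic rules), $\succ$ is an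 irreflexive and transitive relation on $\mathbb L$, and $\mathbb U$ (the undefeatable rules) is a set of $\succ$-maximal elements of $\mathbb L$; an element $L$ of a set of rules is maximal in it if no $L'$ in that set has $L'\succ L$. The sets $\mathbb L$, $\mathbb U$ and the rules themselves may be empty. The hierarchy of $\mathtt C$ is the sequence $(\mathbb L_0,\dots,\mathbb L_n)$ where $\mathbb L_0$ is the set of maximal elements of $\mathbb L$ and, as long as $\mathbb L_0\cup\dots\cup\mathbb L_k\ne\mathbb L$, $\mathbb L_{k+1}$ is the set of maximal elements of $\mathbb L\setminus(\mathbb L_0\cup\dots\cup\mathbb L_k)$. With the convention that $\bigcap\emptyset$ is the set of all timelines, the accepted timelines are those in $\bigcap\mathbb U$. If $\bigcap\mathbb L_0=\emptyset$, no timeline is expected; otherwise the expected timelines are those in $\bigcap\mathbb L_0\cap\dots\cap\bigcap\mathbb L_k$, where $(\mathbb L_0,\dots,\mathbb L_k)$ is the longest initial segment of the hierarchy for which this intersection is nonempty. *Truth and validity.* For a timeline $\pi$ and $i\in\mathbb N$: $\mathtt M,\mathtt C,\pi,i\Vdash p$ iff $\pi[i]\in V(p)$; $\bot$ is never true; $\neg$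 and $\land$ are classical; $\mathtt M,\mathtt C,\pi,i\Vdash\mathtt X\phi$ iff $\mathtt M,\mathtt C,\pi,i+1\Vdash\phi$; $\mathtt M,\mathtt C,\pi,i\Vdash\mathtt Y\phi$ iff $i=0$ or $\mathtt M,\mathtt C,\pi,i-1\Vdash\phi$; $\mathtt M,\mathtt C,\pi,i\Vdash[\mathtt S]\phi$ (respectively $[\mathtt W]\phi$) iff $\mathtt M,\mathtt C,\pi',i\Vdash\phi$ for every accepted (respectively expected) timeline $\pi'$. A formula is valid if it is true at every contextualized pointed model $(\mathtt M,\mathtt C,\pi,i)$, that is, for every model $\mathtt M$, context $\mathtt C$ for $\mathtt M$, accepted timeline $\pi$ and $i\in\mathbb N$. *The system.* Closed formulas are $\chi ::= [\mathtt S]\phi\mid[\mathtt W]\phi\mid\neg\chi\mid(\chi\land\chi)$ with $\phi$ any formula. The axioms of $\mathsf{SWONBT}$ are, for all formulas $\phi,\psi$, all closed formulas $\chi$ and all formulas $\alpha$ built from atoms and $\bot$ by $\neg,\land$ only: 1. all instances of propositional tautologies; 2. $\mathtt X\neg\phi\leftrightarrow\neg\mathtt X\phi$; $\ \mathtt X(\phi\land\psi)\leftrightarrow(\mathtt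 X\phi\land\mathtt X\psi)$; $\ \mathtt X\mathtt Y\phi\leftrightarrow\phi$; $\ \mathtt X[\mathtt S]\phi\leftrightarrow[\mathtt S]\mathtt X\phi$; $\ \mathtt X[\mathtt W]\phi\leftrightarrow[\mathtt W]\mathtt X\phi$; $\ \neg\mathtt X\neg\top$; 3. $\mathtt Y\neg\phi\leftrightarrow(\mathtt Y\bot\lor\neg\mathtt Y\phi)$; $\ \mathtt Y(\phi\land\psi)\leftrightarrow(\mathtt Y\phi\land\mathtt Y\psi)$; $\ \mathtt Y\mathtt X\phi\leftrightarrow(\mathtt Y\bot\lor\phi)$; $\ \mathtt Y[\mathtt S]\phi\leftrightarrow[\mathtt S]\mathtt Y\phi$; $\ \mathtt Y[\mathtt W]\phi\leftrightarrow[\mathtt W]\mathtt Y\phi$; $\ \langle\mathtt S\rangle\mathtt Y\bot\to(\langle\mathtt S\rangle\alpha\to\alpha)$; 4. $[\mathtt S](\phi\to\psi)\to([\mathtt S]\phi\to[\mathtt S]\psi)$; $\ [\mathtt S](\chi\lor\phi)\leftrightarrow(\chi\lor[\mathtt S]\phi)$; $\ [\mathtt S]\phi\to\phi$; 5. $[\mathtt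 W](\phi\to\psi)\to([\mathtt W]\phi\to[\mathtt W]\psi)$; $\ [\mathtt W](\chi\lor\phi)\leftrightarrow(\chi\lor[\mathtt W]\phi)$; 6. $[\mathtt S]\phi\to[\mathtt W]\phi$. The rules are modus ponens; from $\phi$ infer $\mathtt X\phi$, $\mathtt Y\phi$, $[\mathtt S]\phi$ and $[\mathtt W]\phi$; and from $\psi\leftrightarrow\psi'$ infer $\phi\leftrightarrow\phi'$, where $\phi'$ results from $\phi$ by replacing occurrences of the subformula $\psi$ by $\psi'$. -/

import Mathlib

universe u w

namespace SWONBT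

/-- Formulas over the set `AP` of atomic propositions:
`φ ::= p | ⊥ | ¬φ | (φ ∧ φ) | X φ | Y φ | [S] φ | [W] φ`. -/
inductive Formula (AP : Type u) : Type u
  | atom : AP → Formula AP
  | bot : Formula AP
  | neg : Formula AP → Formula AP
  | conj : Formula AP → Formula AP → Formula AP
  /-- `X φ`: `φ` at the next moment. -/
  | X : Formula AP → Formula AP
  /-- `Y φ`: `φ` at the last moment. -/
  | Y : Formula AP → Formula AP
  /-- `[S] φ`: `φ` must be true now. -/
  | S : Formula AP → Formula AP
  /-- `[W] φ`: `φ` should be true now. -/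
  | W : Formula AP → Formula AP

namespace Formula

variable {AP : Type u}

/-- `⊤ := ¬⊥`. -/
def top : Formula AP := neg bot

/-- `φ ∨ ψ := ¬(¬φ ∧ ¬ψ)`. -/
def disj (φ ψ : Formula AP) : Formula AP := neg (conj (neg φ) (neg ψ))

/-- `φ → ψ := ¬(φ ∧ ¬ψ)`. -/
def imp (φ ψ : Formula AP) : Formula AP := neg (conj φ (neg ψ))

/-- `φ ↔ ψ := (φ → ψ) ∧ (ψ → φ)`. -/
def iff (φ ψ : Formula AP) : Formula AP := conj (imp φ ψ) (imp ψ φ)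

/-- `⟨S⟩ φ := ¬[S]¬φ`. -/
def diaS (φ : Formula AP) : Formula AP := neg (S (neg φ))

/-- The formulas of propositional logic: `α ::= p | ⊥ | ¬α | (α ∧ α)`. -/
inductive IsPL : Formula AP → Prop
  | atom (p : AP) : IsPL (atom p)
  | bot : IsPL bot
  | neg {α : Formula AP} : IsPL α → IsPL (neg α)
  | conj {α β : Formula AP} : IsPL α → IsPL β → IsPL (conj α β)

/-- The closed formulas: `χ ::= [S] φ | [W] φ | ¬χ | (χ ∧ χ)`, with `φ` an arbitrary formula. -/
inductive Closed : Formula AP → Prop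
  | S (φ : Formula AP) : Closed (S φ)
  | W (φ : Formula AP) : Closed (W φ)
  | neg {χ : Formula AP} : Closed χ → Closed (neg χ)
  | conj {χ θ : Formula AP} : Closed χ → Closed θ → Closed (conj χ θ)

/-- `φ` is (a substitution instance of) a propositional tautology: it is true under every
assignment of truth values to formulas that respects `⊥`, `¬` and `∧` (so that atoms and formulas
beginning with `X`, `Y`, `[S]`, `[W]` are treated as propositional variables). -/
def IsTautology (φ : Formula AP) : Prop :=
  ∀ v : Formula AP → Prop,
    ¬ v bot → (∀ ψ, v (neg ψ) ↔ ¬ v ψ) → (∀ ψ θ, v (conj ψ θ) ↔ v ψ ∧ v θ) → v φ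

/-- `Replaces ψ ψ' φ φ'`: the formula `φ'` results from `φ` by replacing some occurrences of the
subformula `ψ` by `ψ'` (one, several or all of them; the degenerate case of none gives `φ' = φ`). -/
inductive Replaces (ψ ψ' : Formula AP) : Formula AP → Formula AP → Prop
  | here : Replaces ψ ψ' ψ ψ'
  | same (φ : Formula AP) : Replaces ψ ψ' φ φ
  | neg {φ φ' : Formula AP} : Replaces ψ ψ' φ φ' → Replaces ψ ψ' (neg φ) (neg φ')
  | conj {φ φ' θ θ' : Formula AP} : Replaces ψ ψ' φ φ' → Replaces ψ ψ' θ θ' →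
      Replaces ψ ψ' (conj φ θ) (conj φ' θ')
  | X {φ φ' : Formula AP} : Replaces ψ ψ' φ φ' → Replaces ψ ψ' (X φ) (X φ')
  | Y {φ φ' : Formula AP} : Replaces ψ ψ' φ φ' → Replaces ψ ψ' (Y φ) (Y φ')
  | S {φ φ' : Formula AP} : Replaces ψ ψ' φ φ' → Replaces ψ ψ' (S φ) (S φ')
  | W {φ φ' : Formula AP} : Replaces ψ ψ' φ φ' → Replaces ψ ψ' (W φ) (W φ')

end Formula

section System

open Formula

/-- Derivability in the Hilbert-style system. -/
inductive Derivable {AP : Type u} : Formula AP → Prop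
  -- propositional logic
  | taut {φ : Formula AP} : IsTautology φ → Derivable φ
  -- axioms for `X`
  | X_neg (φ : Formula AP) : Derivable (iff (X (neg φ)) (neg (X φ)))
  | X_and (φ ψ : Formula AP) : Derivable (iff (X (conj φ ψ)) (conj (X φ) (X ψ)))
  | X_Y (φ : Formula AP) : Derivable (iff (X (Y φ)) φ)
  | X_S (φ : Formula AP) : Derivable (iff (X (S φ)) (S (X φ)))
  | X_W (φ : Formula AP) : Derivable (iff (X (W φ)) (W (X φ)))
  | X_top : Derivable (neg (X (neg top)))
  -- axioms for `Y`
  | Y_neg (φ : Formula AP) : Derivable (iff (Y (neg φ)) (disj (Y bot) (neg (Y φ))))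
  | Y_and (φ ψ : Formula AP) : Derivable (iff (Y (conj φ ψ)) (conj (Y φ) (Y ψ)))
  | Y_X (φ : Formula AP) : Derivable (iff (Y (X φ)) (disj (Y bot) φ))
  | Y_S (φ : Formula AP) : Derivable (iff (Y (S φ)) (S (Y φ)))
  | Y_W (φ : Formula AP) : Derivable (iff (Y (W φ)) (W (Y φ)))
  | Y_bot {α : Formula AP} : IsPL α → Derivable (imp (diaS (Y bot)) (imp (diaS α) α))
  -- axioms for `[S]`
  | S_K (φ ψ : Formula AP) : Derivable (imp (S (imp φ ψ)) (imp (S φ) (S ψ)))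
  | S_or {χ : Formula AP} (φ : Formula AP) : Closed χ →
      Derivable (iff (S (disj χ φ)) (disj χ (S φ)))
  | S_T (φ : Formula AP) : Derivable (imp (S φ) φ)
  -- axioms for `[W]`
  | W_K (φ ψ : Formula AP) : Derivable (imp (W (imp φ ψ)) (imp (W φ) (W ψ)))
  | W_or {χ : Formula AP} (φ : Formula AP) : Closed χ →
      Derivable (iff (W (disj χ φ)) (disj χ (W φ)))
  -- `[S]` is stronger than `[W]`
  | S_W (φ : Formula AP) : Derivable (imp (S φ) (W φ))
  -- inference rules
  | mp {φ ψ : Formula AP} : Derivable φ → Derivable (imp φ ψ) → Derivable ψ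
  | gen_X {φ : Formula AP} : Derivable φ → Derivable (X φ)
  | gen_Y {φ : Formula AP} : Derivable φ → Derivable (Y φ)
  | gen_S {φ : Formula AP} : Derivable φ → Derivable (S φ)
  | gen_W {φ : Formula AP} : Derivable φ → Derivable (W φ)
  | replace {ψ ψ' φ φ' : Formula AP} : Derivable (iff ψ ψ') → Replaces ψ ψ' φ φ' →
      Derivable (iff φ φ')

end System

/-- Models: serial discrete rooted trees with a valuation. The condition `unique_path` says that
for every state `x` there is exactly one finite sequence `x₀ < ⋯ < xₙ` (consecutive elements
related, `n ≥ 0`) with `x₀` the root and `xₙ = x`; it determines the root. -/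
structure Model (AP : Type u) where
  State : Type w
  lt : State → State → Prop
  root : State
  serial : ∀ x, ∃ y, lt x y
  unique_path : ∀ x, ∃! l : List State,
    l.IsChain lt ∧ l.head? = some root ∧ l.getLast? = some x
  V : AP → Set State

/-- Timelines of `M`: infinite sequences `root = x₀ < x₁ < ⋯`. -/
def Model.Timeline {AP : Type u} (M : Model.{u, w} AP) : Type w :=
  {π : ℕ → M.State // π 0 = M.root ∧ ∀ i, M.lt (π i) (π (i + 1))}

/-- `L` is a maximal element of `A` with respect to `higher`
(`higher K L` reads: `K` has higher priority than `L`). -/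
def IsMaximalIn {α : Type w} (higher : α → α → Prop) (A : Set α) (L : α) : Prop :=
  L ∈ A ∧ ∀ K ∈ A, ¬ higher K L

/-- Contexts for `M`: finitely many ontic rules (sets of timelines), an irreflexive and transitive
priority relation on them, and a set of undefeatable rules among the maximal ones. -/
structure Context {AP : Type u} (M : Model.{u, w} AP) where
  rules : Set (Set M.Timeline)
  finite_rules : rules.Finite
  higher : Set M.Timeline → Set M.Timeline → Prop
  /-- `higher` is a relation on `rules`, that is, a subset of `rules × rules`. -/
  higher_on_rules : ∀ K L, higher K L → K ∈ rules ∧ L ∈ rules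
  irrefl : ∀ L, ¬ higher L L
  trans : ∀ J K L, higher J K → higher K L → higher J L
  undefeatable : Set (Set M.Timeline)
  undefeatable_maximal : ∀ L ∈ undefeatable, IsMaximalIn higher rules L

namespace Context

variable {AP : Type u} {M : Model.{u, w} AP} (C : Context M)

/-- The rules that are left when the first `k` levels of the hierarchy have been removed. -/
def remaining : ℕ → Set (Set M.Timeline)
  | 0 => C.rules
  | k + 1 => remaining k \ {L | IsMaximalIn C.higher (remaining k) L}

/-- The level `𝕃ₖ` of the hierarchy: the maximal elements of `𝕃 - (𝕃₀ ∪ ⋯ ∪ 𝕃ₖ₋₁)`. -/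
def level (k : ℕ) : Set (Set M.Timeline) :=
  {L | IsMaximalIn C.higher (C.remaining k) L}

/-- The index `k` occurs in the hierarchy `(𝕃₀, …, 𝕃ₙ)`: the construction has not stopped before
step `k`, that is, `𝕃₀ ∪ ⋯ ∪ 𝕃ⱼ ≠ 𝕃` for every `j < k`. -/
def InHierarchy (k : ℕ) : Prop :=
  ∀ j < k, (⋃ i ≤ j, C.level i) ≠ C.rules

/-- The timelines `⋂𝕃₀ ∩ ⋯ ∩ ⋂𝕃ₖ` that satisfy all rules of the levels `0, …, k`
(the intersection of no rules is the set of all timelines). -/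
def segment (k : ℕ) : Set M.Timeline :=
  ⋂ j ≤ k, ⋂₀ C.level j

/-- The accepted timelines `⋂𝕌` (all timelines if `𝕌` is empty). -/
def accepted : Set M.Timeline :=
  ⋂₀ C.undefeatable

/-- The expected timelines: those in `⋂𝕃₀ ∩ ⋯ ∩ ⋂𝕃ₖ`, where `(𝕃₀, …, 𝕃ₖ)` is the longest initial
segment of the hierarchy for which this intersection is nonempty. There is no such segment, and
hence no expected timeline, if `⋂𝕃₀` is empty. -/
def expected : Set M.Timeline :=
  {π | ∃ k, C.InHierarchy k ∧ (C.segment k).Nonempty ∧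
    (∀ m, C.InHierarchy m → (C.segment m).Nonempty → m ≤ k) ∧ π ∈ C.segment k}

end Context

/-- Truth of a formula at a model with a context, a timeline `π` and a time `i`. -/
def Sat {AP : Type u} {M : Model.{u, w} AP} (C : Context M) :
    M.Timeline → ℕ → Formula AP → Prop
  | π, i, .atom p => π.1 i ∈ M.V p
  | _, _, .bot => False
  | π, i, .neg φ => ¬ Sat C π i φ
  | π, i, .conj φ ψ => Sat C π i φ ∧ Sat C π i ψ
  | π, i, .X φ => Sat C π (i + 1) φ
  | π, i, .Y φ => 0 < i → Sat C π (i - 1) φ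
  | _, i, .S φ => ∀ π' ∈ C.accepted, Sat C π' i φ
  | _, i, .W φ => ∀ π' ∈ C.expected, Sat C π' i φ

/-- Validity: truth at all contextualized pointed models `(M, C, π, i)`, where `π` has to be an
accepted timeline. -/
def Valid {AP : Type u} (φ : Formula AP) : Prop :=
  ∀ (M : Model.{u, w} AP) (C : Context M), ∀ π ∈ C.accepted, ∀ i : ℕ, Sat C π i φ

end SWONBT

/-! Soundness is an induction on derivations, with truth claimed at accepted timelines only. For
completeness, an underivable `φ` is missing from some maximal consistent set. Going back in time
from it (`exists_past`) reaches a set `Γ` that is either initial (`Y bot ∈ Γ`) or as many steps back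
as `Y` is nested in `φ`. The maximal consistent sets containing `S ⁻¹' Γ` are taken as timelines:
such a `Δ` makes `p` true at time `i` iff `X^i p ∈ Δ`. Those that also contain `W ⁻¹' Γ` are the
expected ones. Closed formulas belong to all these sets or to none (`closed_mem_iff`), and `X`
commutes with `S` and `W`; hence truth is membership (`sat_iff_iterate_X_mem`). The timelines are
realized as the teeth of a comb, sharing only the root, with two rules and no priorities
(`exists_context`). The root needs one valuation: if `Γ` is initial, axiom `Y_bot` makes the sets
agree on atoms; otherwise a dummy root is put before time 0, and the nesting bound keeps `φ` from
looking back at it. -/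

namespace SWONBT

/-! ### Soundness -/

section Soundness

open Formula

variable {AP : Type u}

namespace Context

variable {M : Model.{u, w} AP} (C : Context M)

/-- Undefeatable rules are maximal, hence in level 0, which every segment includes. This validates
`S_W`, and also `gen_W` and `replace`, whose premises are known at accepted timelines only. -/
theorem expected_subset_accepted : C.expected ⊆ C.accepted := by
  rintro π ⟨k, -, -, -, hπ⟩ L hL
  simp only [segment, Set.mem_iInter] at hπ
  exact hπ 0 (Nat.zero_le k) L (C.undefeatable_maximal L hL)

end Context

section Sat

variable {M : Model.{u, w} AP} {C : Context M} {π π' : M.Timeline} {i : ℕ} {φ ψ : Formula AP}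

@[simp] theorem sat_imp : Sat C π i (imp φ ψ) ↔ (Sat C π i φ → Sat C π i ψ) := by
  simp only [imp, Sat]; tauto

@[simp] theorem sat_disj : Sat C π i (disj φ ψ) ↔ (Sat C π i φ ∨ Sat C π i ψ) := by
  simp only [disj, Sat]; tauto

@[simp] theorem sat_iff : Sat C π i (iff φ ψ) ↔ (Sat C π i φ ↔ Sat C π i ψ) := by
  simp only [iff, Sat, sat_imp]; tauto

theorem sat_closed_congr {χ : Formula AP} (hχ : Closed χ) (π π' : M.Timeline) (i : ℕ) :
    Sat C π i χ ↔ Sat C π' i χ := by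
  induction hχ with
  | S φ => simp only [Sat]
  | W φ => simp only [Sat]
  | neg _ ih => simp only [Sat, ih]
  | conj _ _ ih₁ ih₂ => simp only [Sat, ih₁, ih₂]

theorem sat_isPL_congr {α : Formula AP} (hα : IsPL α) (h : π.1 i = π'.1 i) :
    Sat C π i α ↔ Sat C π' i α := by
  induction hα with
  | atom p => simp only [Sat, h]
  | bot => simp only [Sat]
  | neg _ ih => simp only [Sat, ih]
  | conj _ _ ih₁ ih₂ => simp only [Sat, ih₁, ih₂]

theorem sat_replaces {φ φ' : Formula AP} (hr : Replaces ψ ψ' φ φ')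
    (h : ∀ π ∈ C.accepted, ∀ i, Sat C π i ψ ↔ Sat C π i ψ') :
    ∀ π ∈ C.accepted, ∀ i, Sat C π i φ ↔ Sat C π i φ' := by
  induction hr with
  | here => exact h
  | same φ => exact fun _ _ _ => Iff.rfl
  | neg _ ih => intro π hπ i; simp only [Sat, ih π hπ i]
  | conj _ _ ih₁ ih₂ => intro π hπ i; simp only [Sat, ih₁ π hπ i, ih₂ π hπ i]
  | X _ ih => intro π hπ i; simp only [Sat, ih π hπ (i + 1)]
  | Y _ ih => intro π hπ i; simp only [Sat, ih π hπ (i - 1)]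
  | S _ ih =>
    intro π _ i
    simp only [Sat]
    exact forall₂_congr fun π' hπ' => ih π' hπ' i
  | W _ ih =>
    intro π _ i
    simp only [Sat]
    exact forall₂_congr fun π' hπ' => ih π' (C.expected_subset_accepted hπ') i

end Sat

theorem Derivable.valid {φ : Formula AP} (h : Derivable φ) : Valid.{u, w} φ := by
  induction h with
  | @taut φ h =>
    intro M C π _ i
    exact h (Sat C π i) (by simp only [Sat, not_false_eq_true])
      (fun ψ => by simp only [Sat]) (fun ψ θ => by simp only [Sat])
  | X_neg | X_and | X_S | X_W | X_Y => intro M C π _ i; simp [Sat]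
  | X_top => intro M C π _ i; simp [Sat, top]
  | Y_neg φ =>
    intro M C π _ i
    rcases Nat.eq_zero_or_pos i with rfl | hi
    · simp [Sat]
    · simp [Sat, hi]
  | Y_and φ ψ => intro M C π _ i; simp only [sat_iff, Sat]; tauto
  | Y_X φ =>
    intro M C π _ i
    cases i <;> simp [Sat]
  | Y_S φ | Y_W φ =>
    intro M C π _ i
    simp only [sat_iff, Sat]
    exact ⟨fun h π' hπ' hi => h hi π' hπ', fun h hi π' hπ' => h π' hπ' hi⟩
  | Y_bot hα =>
    intro M C π _ i
    simp only [sat_imp, diaS, Sat, not_forall, not_not]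
    rintro ⟨π', -, hi⟩ ⟨π'', -, h⟩
    -- `Y bot` holds only at time 0, where all timelines are at the root.
    obtain rfl : i = 0 := Nat.eq_zero_of_not_pos fun h => hi ⟨h, id⟩
    exact (sat_isPL_congr hα (π''.2.1.trans π.2.1.symm)).1 h
  | S_K φ ψ | W_K φ ψ =>
    intro M C π _ i
    simp only [sat_imp, Sat]
    exact fun h h' π' hπ' => h π' hπ' (h' π' hπ')
  | S_or φ hχ | W_or φ hχ =>
    intro M C π _ i
    simp only [sat_iff, sat_disj, Sat, ← forall_or_left]
    exact forall₂_congr fun π' _ => or_congr_left (sat_closed_congr hχ π' π i)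
  | S_T φ =>
    intro M C π hπ i
    simp only [sat_imp, Sat]
    exact fun h => h π hπ
  | S_W φ =>
    intro M C π _ i
    simp only [sat_imp, Sat]
    exact fun h π' hπ' => h π' (C.expected_subset_accepted hπ')
  | mp _ _ ih₁ ih₂ => exact fun M C π hπ i => sat_imp.1 (ih₂ M C π hπ i) (ih₁ M C π hπ i)
  | gen_X _ ih => intro M C π hπ i; simpa only [Sat] using ih M C π hπ (i + 1)
  | gen_Y _ ih => intro M C π hπ i; simpa only [Sat] using fun _ => ih M C π hπ (i - 1)
  | gen_S _ ih => intro M C π hπ i; simpa only [Sat] using fun π' hπ' => ih M C π' hπ' i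
  | gen_W _ ih =>
    intro M C π hπ i
    simpa only [Sat] using fun π' hπ' => ih M C π' (C.expected_subset_accepted hπ') i
  | replace _ hr ih =>
    exact fun M C π hπ i =>
      sat_iff.2 (sat_replaces hr (fun π hπ i => sat_iff.1 (ih M C π hπ i)) π hπ i)

end Soundness

/-! ### Maximal consistent sets -/

section MaximalConsistent

open Formula

variable {AP : Type u}

/-- Maximal consistent sets: sets of formulas that contain all derivable formulas and respect the
Boolean connectives. -/
structure IsMaxConsistent (Γ : Set (Formula AP)) : Prop where
  of_derivable : ∀ {φ}, Derivable φ → φ ∈ Γ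
  bot_notMem : bot ∉ Γ
  neg_mem : ∀ {φ}, neg φ ∈ Γ ↔ φ ∉ Γ
  conj_mem : ∀ {φ ψ}, conj φ ψ ∈ Γ ↔ φ ∈ Γ ∧ ψ ∈ Γ

/-- Theories: sets of formulas that contain all derivable formulas and are closed under modus
ponens. -/
structure IsTheory (Γ : Set (Formula AP)) : Prop where
  of_derivable : ∀ {φ}, Derivable φ → φ ∈ Γ
  mp : ∀ {φ ψ}, imp φ ψ ∈ Γ → φ ∈ Γ → ψ ∈ Γ

namespace IsTheory

variable {Γ : Set (Formula AP)}

theorem derivable : IsTheory {φ : Formula AP | Derivable φ} := ⟨id, fun h h' => h'.mp h⟩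

theorem taut₁ (h : IsTheory Γ) {φ ψ : Formula AP} (ht : IsTautology (imp φ ψ)) (hφ : φ ∈ Γ) :
    ψ ∈ Γ :=
  h.mp (h.of_derivable (.taut ht)) hφ

theorem taut₂ (h : IsTheory Γ) {φ ψ θ : Formula AP} (ht : IsTautology (imp φ (imp ψ θ)))
    (hφ : φ ∈ Γ) (hψ : ψ ∈ Γ) : θ ∈ Γ :=
  h.mp (h.taut₁ ht hφ) hψ

theorem sUnion {c : Set (Set (Formula AP))} (hc : ∀ Γ ∈ c, IsTheory Γ) (hchain : IsChain (· ⊆ ·) c)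
    (hne : c.Nonempty) : IsTheory (⋃₀ c) where
  of_derivable h := let ⟨Γ, hΓ⟩ := hne; ⟨Γ, hΓ, (hc Γ hΓ).of_derivable h⟩
  mp := by
    rintro φ ψ ⟨Γ, hΓ, h⟩ ⟨Δ, hΔ, h'⟩
    rcases hchain.total hΓ hΔ with hs | hs
    · exact ⟨Δ, hΔ, (hc Δ hΔ).mp (hs h) h'⟩
    · exact ⟨Γ, hΓ, (hc Γ hΓ).mp h (hs h')⟩

theorem adjoin (h : IsTheory Γ) (ψ : Formula AP) : IsTheory {θ | imp ψ θ ∈ Γ} where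
  of_derivable hd := h.taut₁
    (fun v _ hn hc => by simp only [imp, hn, hc]; tauto) (h.of_derivable hd)
  mp h₁ h₂ := h.taut₂ (fun v _ hn hc => by simp only [imp, hn, hc]; tauto) h₁ h₂

/-- Lindenbaum's lemma. -/
theorem exists_isMaxConsistent (h : IsTheory Γ) {φ : Formula AP} (hφ : φ ∉ Γ) :
    ∃ Δ, Γ ⊆ Δ ∧ IsMaxConsistent Δ ∧ φ ∉ Δ := by
  obtain ⟨Δ, hΓΔ, hΔ⟩ := zorn_subset_nonempty {Δ | IsTheory Δ ∧ φ ∉ Δ}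
    (fun c hc hchain hne => ⟨⋃₀ c, ⟨sUnion (fun Δ hΔ => (hc hΔ).1) hchain hne,
      fun ⟨Δ, hΔ, h'⟩ => (hc hΔ).2 h'⟩, fun Δ hΔ => Set.subset_sUnion_of_mem hΔ⟩) Γ ⟨h, hφ⟩
  obtain ⟨hth, hφΔ⟩ := hΔ.prop
  -- Otherwise adjoining `ψ` would give a larger theory that still omits `φ`.
  have himp : ∀ {ψ}, ψ ∉ Δ → imp ψ φ ∈ Δ := by
    intro ψ hψ
    by_contra hcon
    have hsub : Δ ⊆ {θ | imp ψ θ ∈ Δ} := fun θ hθ =>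
      hth.taut₁ (fun v _ hn hc => by simp only [imp, hn, hc]; tauto) hθ
    exact hψ (hΔ.le_of_ge ⟨hth.adjoin ψ, hcon⟩ hsub
      (hth.of_derivable (.taut fun v _ hn hc => by simp only [imp, hn, hc]; tauto)))
  refine ⟨Δ, hΓΔ, ⟨hth.of_derivable, ?_, ?_, ?_⟩, hφΔ⟩
  · exact fun hb => hφΔ (hth.taut₁ (fun v hb hn hc => by simp only [imp, hn, hc]; tauto) hb)
  · intro ψ
    constructor
    · exact fun h₁ h₂ =>
        hφΔ (hth.taut₂ (fun v hb hn hc => by simp only [imp, hn, hc]; tauto) h₁ h₂)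
    · intro hψ
      by_contra hn
      exact hφΔ (hth.taut₂ (fun v hb hn hc => by simp only [imp, hn, hc]; tauto)
        (himp hψ) (himp hn))
  · intro ψ θ
    exact ⟨fun h => ⟨hth.taut₁ (fun v _ hn hc => by simp only [imp, hn, hc]; tauto) h,
        hth.taut₁ (fun v _ hn hc => by simp only [imp, hn, hc]; tauto) h⟩,
      fun ⟨h₁, h₂⟩ => hth.taut₂ (fun v _ hn hc => by simp only [imp, hn, hc]; tauto) h₁ h₂⟩

end IsTheory

namespace IsMaxConsistent

variable {Γ : Set (Formula AP)} {φ ψ χ : Formula AP}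

theorem imp_mem (h : IsMaxConsistent Γ) : imp φ ψ ∈ Γ ↔ (φ ∈ Γ → ψ ∈ Γ) := by
  simp only [imp, h.neg_mem, h.conj_mem]; tauto

theorem disj_mem (h : IsMaxConsistent Γ) : disj φ ψ ∈ Γ ↔ φ ∈ Γ ∨ ψ ∈ Γ := by
  simp only [disj, h.neg_mem, h.conj_mem]; tauto

theorem iff_mem (h : IsMaxConsistent Γ) : iff φ ψ ∈ Γ ↔ (φ ∈ Γ ↔ ψ ∈ Γ) := by
  simp only [iff, h.conj_mem, h.imp_mem]; tauto

theorem mem_congr (h : IsMaxConsistent Γ) (hd : Derivable (iff φ ψ)) : φ ∈ Γ ↔ ψ ∈ Γ :=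
  h.iff_mem.1 (h.of_derivable hd)

theorem mem_of_imp (h : IsMaxConsistent Γ) (hd : Derivable (imp φ ψ)) : φ ∈ Γ → ψ ∈ Γ :=
  h.imp_mem.1 (h.of_derivable hd)

theorem preimage_X (h : IsMaxConsistent Γ) : IsMaxConsistent (Formula.X ⁻¹' Γ) where
  of_derivable hd := h.of_derivable hd.gen_X
  bot_notMem hb := by
    have : X (neg bot) ∈ Γ :=
      h.of_derivable (.gen_X (.taut fun v hb hn _ => (hn _).2 hb))
    exact h.neg_mem.1 ((h.mem_congr (.X_neg bot)).1 this) hb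
  neg_mem := (h.mem_congr (.X_neg _)).trans h.neg_mem
  conj_mem := (h.mem_congr (.X_and _ _)).trans h.conj_mem

theorem preimage_iterate_X (h : IsMaxConsistent Γ) :
    ∀ i : ℕ, IsMaxConsistent ((Formula.X)^[i] ⁻¹' Γ)
  | 0 => h
  | i + 1 => (preimage_iterate_X h i).preimage_X

theorem iterate_X_S_mem (h : IsMaxConsistent Γ) (i : ℕ) :
    ∀ {φ}, (Formula.X)^[i] (S φ) ∈ Γ ↔ S ((Formula.X)^[i] φ) ∈ Γ := by
  induction i with
  | zero => exact Iff.rfl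
  | succ i ih => exact fun {φ} => ((h.preimage_iterate_X i).mem_congr (.X_S φ)).trans ih

theorem iterate_X_W_mem (h : IsMaxConsistent Γ) (i : ℕ) :
    ∀ {φ}, (Formula.X)^[i] (W φ) ∈ Γ ↔ W ((Formula.X)^[i] φ) ∈ Γ := by
  induction i with
  | zero => exact Iff.rfl
  | succ i ih => exact fun {φ} => ((h.preimage_iterate_X i).mem_congr (.X_W φ)).trans ih

theorem preimage_Y (h : IsMaxConsistent Γ) (hb : Y bot ∉ Γ) :
    IsMaxConsistent (Formula.Y ⁻¹' Γ) where
  of_derivable hd := h.of_derivable hd.gen_Y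
  bot_notMem := hb
  neg_mem {φ} := (h.mem_congr (.Y_neg φ)).trans
    (h.disj_mem.trans ((or_iff_right hb).trans h.neg_mem))
  conj_mem := (h.mem_congr (.Y_and _ _)).trans h.conj_mem

/-- The replacement rule, applied to `bot ↔ bot ∧ φ` under `Y`, does the work of monotonicity of
`Y`. -/
theorem Y_mem_of_Y_bot_mem (h : IsMaxConsistent Γ) (hb : Y bot ∈ Γ) (φ : Formula AP) : Y φ ∈ Γ := by
  have hd : Derivable (iff (Y bot) (Y (conj bot φ))) :=
    .replace (ψ := bot) (ψ' := conj bot φ)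
      (.taut fun v _ hn hc => by simp only [iff, imp, hn, hc]; tauto) (.Y .here)
  exact (h.conj_mem.1 ((h.mem_congr (.Y_and _ _)).1 ((h.mem_congr hd).1 hb))).2

theorem S_Y_bot_mem (h : IsMaxConsistent Γ) (hb : Y bot ∈ Γ) : S (Y bot) ∈ Γ :=
  (h.mem_congr (.Y_S bot)).1 (h.Y_mem_of_Y_bot_mem hb _)

theorem isTheory_preimage_S (h : IsMaxConsistent Γ) : IsTheory (Formula.S ⁻¹' Γ) where
  of_derivable hd := h.of_derivable hd.gen_S
  mp h₁ := h.imp_mem.1 (h.mem_of_imp (.S_K _ _) h₁)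

theorem isTheory_preimage_W (h : IsMaxConsistent Γ) : IsTheory (Formula.W ⁻¹' Γ) where
  of_derivable hd := h.of_derivable hd.gen_W
  mp h₁ := h.imp_mem.1 (h.mem_of_imp (.W_K _ _) h₁)

theorem S_mem_iff (h : IsMaxConsistent Γ) :
    S φ ∈ Γ ↔ ∀ Δ, IsMaxConsistent Δ → Formula.S ⁻¹' Γ ⊆ Δ → φ ∈ Δ := by
  refine ⟨fun hφ Δ _ hs => hs hφ, fun H => ?_⟩
  by_contra hφ
  obtain ⟨Δ, hs, hΔ, hn⟩ := h.isTheory_preimage_S.exists_isMaxConsistent hφ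
  exact hn (H Δ hΔ hs)

theorem W_mem_iff (h : IsMaxConsistent Γ) :
    W φ ∈ Γ ↔ ∀ Δ, IsMaxConsistent Δ → Formula.W ⁻¹' Γ ⊆ Δ → φ ∈ Δ := by
  refine ⟨fun hφ Δ _ hs => hs hφ, fun H => ?_⟩
  by_contra hφ
  obtain ⟨Δ, hs, hΔ, hn⟩ := h.isTheory_preimage_W.exists_isMaxConsistent hφ
  exact hn (H Δ hΔ hs)

theorem preimage_S_subset (h : IsMaxConsistent Γ) : Formula.S ⁻¹' Γ ⊆ Γ :=
  fun _ => h.mem_of_imp (.S_T _)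

theorem preimage_S_subset_preimage_W (h : IsMaxConsistent Γ) : Formula.S ⁻¹' Γ ⊆ Formula.W ⁻¹' Γ :=
  fun _ => h.mem_of_imp (.S_W _)

/-- Axiom `S_or` with `bot` as second disjunct yields `S (χ ∨ bot)` from `χ`, so `χ` passes from `Γ`
to `Δ`. The converse follows because closed formulas are stable under negation. -/
theorem closed_mem_iff (h : IsMaxConsistent Γ) {Δ : Set (Formula AP)} (hΔ : IsMaxConsistent Δ)
    (hs : Formula.S ⁻¹' Γ ⊆ Δ)
    (hχ : Closed χ) : χ ∈ Δ ↔ χ ∈ Γ := by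
  have key : ∀ {χ}, Closed χ → χ ∈ Γ → χ ∈ Δ := fun {χ} hχ hm =>
    (hΔ.disj_mem.1 (hs ((h.mem_congr (.S_or bot hχ)).2 (h.disj_mem.2 (.inl hm))))).resolve_right
      hΔ.bot_notMem
  refine ⟨fun hm => ?_, key hχ⟩
  by_contra hn
  exact hΔ.neg_mem.1 (key hχ.neg (h.neg_mem.2 hn)) hm

theorem diaS_mem (h : IsMaxConsistent Γ) (hφ : φ ∈ Γ) : diaS φ ∈ Γ :=
  h.neg_mem.2 fun hS => h.neg_mem.1 (h.mem_of_imp (.S_T _) hS) hφ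

/-- `diaS φ` is closed, so it travels from `Δ` through `Γ` to `Θ`, where `Y_bot` removes the
diamond. -/
theorem isPL_mem_of_mem (h : IsMaxConsistent Γ) {Δ Θ : Set (Formula AP)} (hΔ : IsMaxConsistent Δ)
    (hsΔ : Formula.S ⁻¹' Γ ⊆ Δ) (hΘ : IsMaxConsistent Θ) (hsΘ : Formula.S ⁻¹' Γ ⊆ Θ)
    (hb : Y bot ∈ Γ) (hφ : IsPL φ) (hm : φ ∈ Δ) : φ ∈ Θ := by
  have hcl : Closed (diaS φ) := .neg (.S _)
  have h₁ : diaS φ ∈ Θ :=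
    (h.closed_mem_iff hΘ hsΘ hcl).2 ((h.closed_mem_iff hΔ hsΔ hcl).1 (hΔ.diaS_mem hm))
  have h₂ : diaS (Y bot) ∈ Θ := hΘ.diaS_mem (hsΘ (h.S_Y_bot_mem hb))
  exact hΘ.imp_mem.1 (hΘ.mem_of_imp (.Y_bot hφ) h₂) h₁

/-- Going back in time from a maximal consistent set by `d` steps, or to the initial moment. -/
theorem exists_past (h : IsMaxConsistent Γ) (d : ℕ) :
    ∃ Δ, IsMaxConsistent Δ ∧ ∃ i, (Y bot ∈ Δ ∨ i = d) ∧
    (Formula.X)^[i] ⁻¹' Δ = Γ := by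
  induction d with
  | zero => exact ⟨Γ, h, 0, .inr rfl, rfl⟩
  | succ d ih =>
    obtain ⟨Δ, hΔ, i, hi, heq⟩ := ih
    by_cases hb : Y bot ∈ Δ
    · exact ⟨Δ, hΔ, i, .inl hb, heq⟩
    · refine ⟨_, hΔ.preimage_Y hb, i + 1, .inr (by rw [hi.resolve_left hb]), ?_⟩
      rw [← heq]
      ext ψ
      simp only [Set.mem_preimage, Function.iterate_succ_apply']
      exact (hΔ.mem_congr (.Y_X _)).trans (hΔ.disj_mem.trans (or_iff_right hb))

end IsMaxConsistent

end MaximalConsistent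

/-! ### Realizing families of valuations by comb models -/

section Realization

variable {AP : Type u}

/-- The comb with teeth indexed by `J`: a root from which the branches `J × ℕ` issue. -/
def combLt {J : Type w} : Option (J × ℕ) → Option (J × ℕ) → Prop
  | none, some (_, n) => n = 0
  | some (j, m), some (k, n) => j = k ∧ n = m + 1
  | _, none => False

/-- The path from the root to a state of the comb. -/
def combPath {J : Type w} : Option (J × ℕ) → List (Option (J × ℕ))
  | none => [none]
  | some (j, n) => none :: (List.range (n + 1)).map fun m => some (j, m)

theorem combPath_eq_append {J : Type w} {x y : Option (J × ℕ)} (h : combLt x y) :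
    combPath y = combPath x ++ [y] := by
  rcases x with _ | ⟨j, m⟩ <;> rcases y with _ | ⟨k, n⟩ <;> simp only [combLt] at h
  · subst h; simp [combPath]
  · obtain ⟨rfl, rfl⟩ := h
    simp [combPath, List.range_succ]

/-- Paths are read from their end: dropping the last state leaves a path to its predecessor. -/
theorem eq_combPath {J : Type w} (l : List (Option (J × ℕ))) :
    ∀ x, l.IsChain combLt → l.head? = some none → l.getLast? = some x → l = combPath x := by
  induction l using List.reverseRecOn with
  | nil => intro x _ h; simp at h
  | append_singleton l y ih =>
    intro x hc hh hl
    obtain rfl : y = x := by simpa using hl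
    rw [List.isChain_append] at hc
    obtain ⟨hc, -, hlt⟩ := hc
    rcases hlast : l.getLast? with _ | z
    · obtain rfl : l = [] := by simpa using hlast
      obtain rfl : y = none := by simpa using hh
      rfl
    · have hne : l ≠ [] := by rintro rfl; simp at hlast
      rw [combPath_eq_append (hlt z hlast y (by simp)),
        ← ih z hc (by rwa [List.head?_append_of_ne_nil _ hne] at hh) hlast]

theorem combPath_spec_some {J : Type w} (j : J) (n : ℕ) :
    (combPath (some (j, n))).IsChain combLt ∧ (combPath (some (j, n))).head? = some none ∧
      (combPath (some (j, n))).getLast? = some (some (j, n)) := by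
  induction n with
  | zero => simp [combPath, combLt]
  | succ n ih =>
    rw [combPath_eq_append (x := some (j, n)) (by simp [combLt])]
    refine ⟨List.isChain_append.2 ⟨ih.1, by simp, ?_⟩, by simp [ih.2.1], by simp⟩
    rw [ih.2.2]
    simp [combLt]

theorem combPath_spec {J : Type w} (x : Option (J × ℕ)) :
    (combPath x).IsChain combLt ∧ (combPath x).head? = some none ∧
      (combPath x).getLast? = some x := by
  rcases x with _ | ⟨j, n⟩
  · simp [combPath]
  · exact combPath_spec_some j n

/-- The model on the comb in which the `n`-th state of the tooth `j` has the valuation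
`v j (n + 1)`, and the root has the valuation `v j₀ 0`. -/
def combModel {J : Type w} (j₀ : J) (v : J → ℕ → Set AP) : Model.{u, w} AP where
  State := Option (J × ℕ)
  lt := combLt
  root := none
  serial
    | none => ⟨some (j₀, 0), rfl⟩
    | some (j, n) => ⟨some (j, n + 1), rfl, rfl⟩
  unique_path x := ⟨combPath x, combPath_spec x, fun l hl => eq_combPath l x hl.1 hl.2.1 hl.2.2⟩
  V p := {x | match x with
    | none => p ∈ v j₀ 0
    | some (j, n) => p ∈ v j (n + 1)}

/-- The timeline that runs along the tooth `j` of the comb. -/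
def combTimeline {J : Type w} (j₀ : J) (v : J → ℕ → Set AP) (j : J) :
    (combModel j₀ v).Timeline :=
  ⟨fun i => match i with
    | 0 => none
    | n + 1 => some (j, n), rfl, fun i => match i with
    | 0 => rfl
    | _ + 1 => ⟨rfl, rfl⟩⟩

/-- The context without priorities whose rules are `A`, which is undefeatable, and `E`. -/
def twoRuleContext {M : Model.{u, w} AP} (A E : Set M.Timeline) : Context M where
  rules := {A, E}
  finite_rules := Set.toFinite _
  higher _ _ := False
  higher_on_rules _ _ := False.elim
  irrefl _ := id
  trans _ _ _ := fun h _ => h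
  undefeatable := {A}
  undefeatable_maximal := by
    rintro L rfl
    exact ⟨.inl rfl, fun _ _ => id⟩

section TwoRuleContext

variable {M : Model.{u, w} AP} (A E : Set M.Timeline)

theorem twoRuleContext_accepted : (twoRuleContext A E).accepted = A := Set.sInter_singleton A

theorem twoRuleContext_level_zero : (twoRuleContext A E).level 0 = {A, E} := by
  ext L
  exact ⟨fun h => h.1, fun h => ⟨h, fun _ _ => id⟩⟩

theorem twoRuleContext_segment_zero : (twoRuleContext A E).segment 0 = A ∩ E := by
  simp [Context.segment, twoRuleContext_level_zero]

theorem twoRuleContext_inHierarchy {k : ℕ} : (twoRuleContext A E).InHierarchy k ↔ k = 0 := by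
  refine ⟨fun h => ?_, ?_⟩
  · by_contra hk
    refine h 0 (Nat.pos_of_ne_zero hk) ?_
    simp only [Nat.le_zero, Set.iUnion_iUnion_eq_left]
    exact twoRuleContext_level_zero A E
  · rintro rfl j hj
    exact absurd hj (Nat.not_lt_zero j)

/-- The hierarchy is the single level `{A, E}`, with intersection `E`. Empty `E` is included: then
nothing is expected. -/
theorem twoRuleContext_expected {A E : Set M.Timeline} (h : E ⊆ A) :
    (twoRuleContext A E).expected = E := by
  ext π
  simp only [Context.expected, twoRuleContext_inHierarchy, Set.mem_ofPred_eq, exists_eq_left,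
    twoRuleContext_segment_zero, Set.inter_eq_self_of_subset_right h]
  exact ⟨fun h => h.2.2, fun h => ⟨⟨π, h⟩, fun m hm _ => hm.le, h⟩⟩

end TwoRuleContext

/-- Every family of sequences of valuations with a common initial valuation, together with a
subfamily, is the family of accepted timelines, together with that of expected ones, of a model
with a context. -/
theorem exists_context {J : Type w} [Nonempty J] (v : J → ℕ → Set AP)
    (hv : ∀ j k, v j 0 = v k 0) (E : Set J) :
    ∃ (M : Model.{u, w} AP) (C : Context M) (t : J → M.Timeline),
      C.accepted = Set.range t ∧ C.expected = t '' E ∧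
        ∀ j i p, (t j).1 i ∈ M.V p ↔ p ∈ v j i := by
  obtain ⟨j₀⟩ := ‹Nonempty J›
  refine ⟨combModel j₀ v, twoRuleContext (Set.range (combTimeline j₀ v)) (combTimeline j₀ v '' E),
    combTimeline j₀ v, twoRuleContext_accepted _ _,
    twoRuleContext_expected (Set.image_subset_range _ _), ?_⟩
  rintro j (_ | i) p
  · rw [hv j j₀]; rfl
  · rfl

end Realization

/-! ### The truth lemma and completeness -/

section Completeness

open Formula

variable {AP : Type u}

/-- The greatest number of nested occurrences of `Y` in a formula. -/
def Formula.depthY : Formula AP → ℕ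
  | .atom _ => 0
  | .bot => 0
  | .neg φ => φ.depthY
  | .conj φ ψ => max φ.depthY ψ.depthY
  | .X φ => φ.depthY
  | .Y φ => φ.depthY + 1
  | .S φ => φ.depthY
  | .W φ => φ.depthY

/-- An injective numbering of the formulas. -/
def Formula.code (f : AP → ℕ) : Formula AP → ℕ
  | .atom p => Nat.pair 0 (f p)
  | .bot => Nat.pair 1 0
  | .neg φ => Nat.pair 2 (φ.code f)
  | .conj φ ψ => Nat.pair 3 (Nat.pair (φ.code f) (ψ.code f))
  | .X φ => Nat.pair 4 (φ.code f)
  | .Y φ => Nat.pair 5 (φ.code f)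
  | .S φ => Nat.pair 6 (φ.code f)
  | .W φ => Nat.pair 7 (φ.code f)

theorem Formula.code_injective {f : AP → ℕ} (hf : Function.Injective f) :
    Function.Injective (Formula.code f) := by
  intro φ
  induction φ with
  | atom p => rintro (_ | _) <;> simp [code, Nat.pair_eq_pair, hf.eq_iff]
  | bot => rintro (_ | _) <;> simp [code, Nat.pair_eq_pair]
  | conj φ ψ ih₁ ih₂ =>
    rintro (_ | _) <;> simp only [code, Nat.pair_eq_pair] <;> try simp
    exact fun h₁ h₂ => ⟨ih₁ h₁, ih₂ h₂⟩
  | neg φ ih | X φ ih | Y φ ih | S φ ih | W φ ih =>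
    rintro (_ | _) <;> simp only [code, Nat.pair_eq_pair] <;> try simp
    exact fun h => ih h

/-- Countability makes sets of formulas small in every universe, so that the countermodel can live
in `Type w`. -/
instance [Countable AP] : Countable (Formula AP) :=
  let ⟨_, hf⟩ := exists_injective_nat AP
  (Formula.code_injective hf).countable

/-- The maximal consistent sets that contain what `Γ` regards as necessary. -/
abbrev Alternative (Γ : Set (Formula AP)) : Type u :=
  {Δ : Set (Formula AP) // IsMaxConsistent Δ ∧ Formula.S ⁻¹' Γ ⊆ Δ}

/-- Truth is membership. The times are shifted by `c`, so that the timelines can be given a common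
past where `Γ` does not describe the initial moment. -/
theorem sat_iff_iterate_X_mem {Γ : Set (Formula AP)} (hΓ : IsMaxConsistent Γ)
    {M : Model.{u, w} AP} {C : Context M} {t : Alternative Γ → M.Timeline} {c : ℕ}
    (hacc : C.accepted = Set.range t)
    (hexp : C.expected = t '' {Δ | Formula.W ⁻¹' Γ ⊆ Δ.1})
    (hV : ∀ Δ i p, (t Δ).1 (i + c) ∈ M.V p ↔ (Formula.X)^[i] (atom p) ∈ Δ.1)
    (φ : Formula AP) : ∀ (Δ : Alternative Γ) (i : ℕ), (Y bot ∈ Γ ∧ c = 0) ∨ φ.depthY ≤ i →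
      (Sat C (t Δ) (i + c) φ ↔ (Formula.X)^[i] φ ∈ Δ.1) := by
  induction φ with
  | atom p => intro Δ i _; simpa only [Sat] using hV Δ i p
  | bot =>
    intro Δ i _
    simp only [Sat, false_iff]
    exact (Δ.2.1.preimage_iterate_X i).bot_notMem
  | neg φ ih =>
    intro Δ i hi
    simp only [Sat, ih Δ i hi]
    exact (Δ.2.1.preimage_iterate_X i).neg_mem.symm
  | conj φ ψ ih₁ ih₂ =>
    intro Δ i hi
    simp only [depthY, max_le_iff] at hi
    simp only [Sat, ih₁ Δ i (hi.imp_right And.left), ih₂ Δ i (hi.imp_right And.right)]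
    exact (Δ.2.1.preimage_iterate_X i).conj_mem.symm
  | X φ ih =>
    intro Δ i hi
    simp only [Sat, Nat.add_right_comm i c 1]
    exact ih Δ (i + 1) (hi.imp_right fun h => Nat.le_succ_of_le h)
  | Y φ ih =>
    intro Δ i hi
    rcases i with _ | i
    -- A formula `Y φ` has positive depth, so at `i = 0` only the initial case is possible, where `Y
    -- φ` is vacuously true.
    · obtain ⟨hb, rfl⟩ := hi.resolve_right (by simp [depthY])
      simpa [Sat] using Δ.2.1.Y_mem_of_Y_bot_mem (Δ.2.2 (hΓ.S_Y_bot_mem hb)) φ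
    · have hd := ih Δ i (hi.imp_right fun h => Nat.le_of_succ_le_succ h)
      have hY : (Formula.X)^[i + 1] (Y φ) ∈ Δ.1 ↔ (Formula.X)^[i] φ ∈ Δ.1 :=
        (Δ.2.1.preimage_iterate_X i).mem_congr (.X_Y φ)
      rw [hY, ← hd]
      simp [Sat, Nat.add_right_comm i 1 c]
  | S φ ih =>
    intro Δ i hi
    -- Moving `S` to the front makes the formula closed, so the question moves from `Δ` to `Γ`.
    rw [Δ.2.1.iterate_X_S_mem i, hΓ.closed_mem_iff Δ.2.1 Δ.2.2 (.S _), hΓ.S_mem_iff]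
    simp only [Sat, hacc, Set.forall_mem_range, fun Θ => ih Θ i hi]
    exact ⟨fun h Θ hΘ hs => h ⟨Θ, hΘ, hs⟩, fun h Θ => h Θ.1 Θ.2.1 Θ.2.2⟩
  | W φ ih =>
    intro Δ i hi
    rw [Δ.2.1.iterate_X_W_mem i, hΓ.closed_mem_iff Δ.2.1 Δ.2.2 (.W _), hΓ.W_mem_iff]
    simp only [Sat, hexp, Set.forall_mem_image, fun Θ => ih Θ i hi]
    exact ⟨fun h Θ hΘ hs => h (x := ⟨Θ, hΘ, hΓ.preimage_S_subset_preimage_W.trans hs⟩) hs,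
      fun h Θ hs => h Θ.1 Θ.2.1 hs⟩

theorem Valid.derivable [Countable AP] {φ : Formula AP} (hφ : Valid.{u, w} φ) : Derivable φ := by
  by_contra hnd
  obtain ⟨Γ', -, hΓ', hφΓ'⟩ := IsTheory.derivable.exists_isMaxConsistent hnd
  obtain ⟨Γ, hΓ, i, hi, rfl⟩ := hΓ'.exists_past φ.depthY
  let e := equivShrink.{w} (Alternative Γ)
  let Γ₀ : Alternative Γ := ⟨Γ, hΓ, hΓ.preimage_S_subset⟩
  have : Nonempty (Shrink.{w} (Alternative Γ)) := ⟨e Γ₀⟩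
  let E : Set (Alternative Γ) := {Δ | Formula.W ⁻¹' Γ ⊆ Δ.1}
  obtain ⟨c, v, hv₀, hv, hc⟩ : ∃ (c : ℕ) (v : Alternative Γ → ℕ → Set AP),
      (∀ Δ Θ, v Δ 0 = v Θ 0) ∧
      (∀ Δ i p, p ∈ v Δ (i + c) ↔ (Formula.X)^[i] (atom p) ∈ Δ.1) ∧
      ((Y bot ∈ Γ ∧ c = 0) ∨ φ.depthY ≤ i) := by
    by_cases hb : Y bot ∈ Γ
    · refine ⟨0, fun Δ i => {p | (Formula.X)^[i] (atom p) ∈ Δ.1}, fun Δ Θ => ?_,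
        fun _ _ _ => Iff.rfl, .inl ⟨hb, rfl⟩⟩
      ext p
      exact ⟨hΓ.isPL_mem_of_mem Δ.2.1 Δ.2.2 Θ.2.1 Θ.2.2 hb (.atom p),
        hΓ.isPL_mem_of_mem Θ.2.1 Θ.2.2 Δ.2.1 Δ.2.2 hb (.atom p)⟩
    -- The dummy root, at time 0, satisfies no atom; `Δ` describes the times from 1 on.
    · exact ⟨1, fun Δ i => {p | 0 < i ∧ (Formula.X)^[i - 1] (atom p) ∈ Δ.1}, by simp, by simp,
        .inr (hi.resolve_left hb).ge⟩
  obtain ⟨M, C, t, hacc, hexp, ht⟩ := exists_context (fun j => v (e.symm j))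
    (fun _ _ => hv₀ _ _) (e '' E)
  have hacc' : C.accepted = Set.range (t ∘ e) := by rw [hacc, e.surjective.range_comp]
  have key := sat_iff_iterate_X_mem hΓ (C := C) (t := t ∘ e) (c := c) hacc'
    (by rw [hexp, Set.image_comp]) (fun Δ i p => by simp [ht, hv]) φ Γ₀ i hc
  exact hφΓ' (key.1 (hφ M C _ (hacc' ▸ Set.mem_range_self Γ₀) _))

end Completeness

end SWONBT

theorem theorem5 (AP : Type u) [Countable AP] (φ : SWONBT.Formula AP) :
    SWONBT.Derivable φ ↔ SWONBT.Valid.{u, w} φ :=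
  ⟨SWONBT.Derivable.valid, SWONBT.Valid.derivable⟩
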